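/- Let $\varphi=\frac{1+\sqrt5}{2}$. For a finite graph $G$ on a vertex set $V$ and $\delta\in[0,1]$, consider the random best-response dynamics on $[0,1]^V$: start from $x(0)=0$; in each step an agent $i\in V$ is chosen uniformly at random, independently of the past, and $x_i$ is replaced by the best response $\max\bigl(0,\,1-\delta\sum_{j\sim i}x_j\bigr)$, the other coordinates being kept. The active set at time $t$ is $A(t)=\{i : x_i(t)>0\}$, the time to obtain the final active set is $\tau=\inf\{t : A(s)=A(t)\text{ for all }s\ge t\}\in[0,\infty]$, and times are measured in rounds, one round being $|V|$ steps. Let $G_{m,n}$ be the disjoint union of $m$ copies of the graph obtained from $n$ paths $v_1^j v_2^j v_3^j v_4^j v_5^j$ $(1\le j\le n)$ by adding the edges $v_4^j v_1^{j+1}$ $(1\le j<n)$. A *reshuffle* at an agent $i$, built up from time $s$ and taking place in the step $t\to t+1$ $(s<t)$, means the following. At all times $s,\dots,t$ agent $i$ is inactive and the union $S\neq\emptyset$ of those components of the subgraph induced by the active set that contain a neighbour of $i$ is the same; inactivity is a best response of $i$ at time $s$; the game on $G[S]$ has an equilibrium $y$ (extended by $0$ outside $S$) with all agents of $S$ active which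 is stable, i.e. $I+\delta\,\mathbf G_S$ is positive definite, where $\mathbf G_S$ is the adjacency matrix of $G[S]$ (equivalently $\delta<1/|\lambda_{\min}(\mathbf G_S)|$, with $1/0=\infty$), but inactivity is not a best response of $i$ to $y$; and $i$ becomes active in the step $t\to t+1$. **Theorem.** For every $\delta\in(1/\varphi,1)$ and all $T,k\in\mathbb N$ there are $m\ge1$ and $n\ge\max(k,1)$ such that on the graph $G_{m,n}$ the following hold. 1. The expected time to obtain the final active set is at least $T$ rounds: $\mathbb E[\tau]/(5mn)\ge T$. 2. With probability at least $1/2$, some copy undergoes a chain of $n$ successive reshuffles: there are times $s_1<t_1<s_2<t_2<\dots<s_n<t_n$ such that for each $j$ a reshuffle at the middle agent $v_3^j$ of the $j$-th path of this copy is built up from time $s_j$ and takes place in the step $t_j\to t_j+1$, and the last one takes place after at least $T$ rounds, $t_n\ge 5mnT$. -/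

import Mathlib

open scoped ENNReal

noncomputable section

namespace NetworkGame

variable {V : Type*} [Fintype V] [DecidableEq V]

open Classical in
/-- The linear best response `max (0, 1 - δ ∑ⱼ gᵢⱼ xⱼ)` of agent `i` to the profile `x`. -/
def bestResponse (G : SimpleGraph V) (δ : ℝ) (x : V → ℝ) (i : V) : ℝ :=
  max 0 (1 - δ * ∑ j, if G.Adj i j then x j else 0)

/-- The best-response dynamics with initial profile `x₀`, where agent `ω t` is the one that
revises its activity level in the step leading from time `t` to time `t + 1`. -/
def trajectory (G : SimpleGraph V) (δ : ℝ) (x₀ : V → ℝ) (ω : ℕ → V) : ℕ → V → ℝ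
  | 0 => x₀
  | t + 1 =>
      Function.update (trajectory G δ x₀ ω t) (ω t)
        (bestResponse G δ (trajectory G δ x₀ ω t) (ω t))

/-- The law of the sequence of revising agents: independent and uniform on `V`. -/
def updateLaw (V : Type*) [Fintype V] [Nonempty V] [MeasurableSpace V] :
    MeasureTheory.Measure (ℕ → V) :=
  MeasureTheory.Measure.infinitePi fun _ : ℕ => (PMF.uniformOfFintype V).toMeasure

/-- The set of agents with a positive activity level. -/
def activeSet (x : V → ℝ) : Set V := {i | 0 < x i}

/-- The first time (in steps) from which on the active set of the sequence of profiles `x`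
never changes again; `∞` if there is no such time. -/
def finalActiveTime (x : ℕ → V → ℝ) : ℝ≥0∞ :=
  ⨅ (t : ℕ) (_ : ∀ s, t ≤ s → activeSet (x s) = activeSet (x t)), (t : ℝ≥0∞)

/-- The expected time needed to obtain the final active set, in rounds of `|V|` steps each. -/
def expectedFinalRounds [Nonempty V] [MeasurableSpace V] (G : SimpleGraph V) (δ : ℝ)
    (x₀ : V → ℝ) : ℝ≥0∞ :=
  ∫⁻ ω, finalActiveTime (trajectory G δ x₀ ω) / (Fintype.card V : ℝ≥0∞) ∂(updateLaw V)

/-- The union of the connected components of the subgraph induced by the active set of `x`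
that contain a neighbour of `i`. -/
def adjacentFragments (G : SimpleGraph V) (x : V → ℝ) (i : V) : Set V :=
  {j | ∃ (hj : j ∈ activeSet x) (k : V) (hk : k ∈ activeSet x),
    G.Adj i k ∧ (G.induce (activeSet x)).Reachable ⟨k, hk⟩ ⟨j, hj⟩}

open Classical in
/-- `y` is an equilibrium of the game on the subgraph induced by `S` in which all agents of `S`
are active (extended by `0` outside `S`), and it is stable as such: all eigenvalues of
`1 + δ G_S` are positive, which means `δ < 1 / |λ_min(G_S)|`. -/
def IsStableLocalEquilibrium (G : SimpleGraph V) (δ : ℝ) (S : Set V) (y : V → ℝ) : Prop :=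
  activeSet y = S ∧ (∀ j, j ∉ S → y j = 0) ∧ (∀ j ∈ S, y j = bestResponse G δ y j) ∧
    (1 + δ • (G.induce S).adjMatrix ℝ).PosDef

open Classical in
/-- A reshuffle at agent `i` in the step from time `t` to time `t + 1`. From time `s` up to time
`t` the agent is inactive and the active fragments `S ≠ ∅` next to it remain the same. Being
inactive is a best response of `i` at time `s`. The fragments have a stable local equilibrium
`y`, but `i` is not willing to remain inactive next to `y`; and in the step from `t` to `t + 1`
agent `i` becomes active. -/
def IsReshuffle (G : SimpleGraph V) (δ : ℝ) (x : ℕ → V → ℝ) (i : V) (s t : ℕ) : Prop :=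
  s < t ∧
  ∃ S : Set V, S.Nonempty ∧
    (∀ r, s ≤ r → r ≤ t → x r i = 0 ∧ adjacentFragments G (x r) i = S) ∧
    bestResponse G δ (x s) i = 0 ∧
    (∃ y : V → ℝ, IsStableLocalEquilibrium G δ S y ∧ 0 < bestResponse G δ y i) ∧
    0 < x (t + 1) i

/-- The disjoint union of `m` copies of the graph obtained from `n` paths on five vertices
(numbered `0, 1, 2, 3, 4`) by joining vertex `3` of each path to vertex `0` of the next one.
The vertex `(c, j, a)` is the vertex `a` of the path `j` in the copy `c`. -/
def chainedPaths (m n : ℕ) : SimpleGraph (Fin m × Fin n × Fin 5) where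
  Adj u v := u.1 = v.1 ∧
    ((u.2.1 = v.2.1 ∧ (SimpleGraph.pathGraph 5).Adj u.2.2 v.2.2) ∨
      ((u.2.1 : ℕ) + 1 = v.2.1 ∧ u.2.2 = 3 ∧ v.2.2 = 0) ∨
      ((v.2.1 : ℕ) + 1 = u.2.1 ∧ v.2.2 = 3 ∧ u.2.2 = 0))
  symm := ⟨fun _ _ h => ⟨h.1.symm, h.2.elim (fun h => Or.inl ⟨h.1.symm, h.2.symm⟩)
    fun h => Or.inr h.symm⟩⟩
  loopless := ⟨fun _ h => by
    rcases h.2 with h | h | h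
    · exact h.2.ne rfl
    · omega
    · omega⟩

/-- In the copy `c`, the middle agents of the paths `0, 1, …, n - 1` undergo reshuffles one after
the other, each one building up only after the previous one has taken place, and the last one
takes place at time `τ` or later. -/
def HasReshuffleChain (m n : ℕ) (δ : ℝ) (x : ℕ → Fin m × Fin n × Fin 5 → ℝ) (c : Fin m)
    (τ : ℕ) : Prop :=
  ∃ s t : Fin n → ℕ,
    (∀ j, IsReshuffle (chainedPaths m n) δ x (c, j, 2) (s j) (t j)) ∧
    (∀ i j, i < j → t i < s j) ∧
    ∃ j, τ ≤ t j

end NetworkGame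

end

/-! Copies do not interact, so it is enough to find a finite word `w` of revisions, depending on `δ`
and `n` but not on `m`, that forces the whole chain of reshuffles in any copy still at its initial
state. A given copy is left unrevised for `2T` rounds with probability `(1 - 1/m)^(10mnT)`, which
stays bounded below as `m` grows, and its next revisions then spell `w` with probability
`(5n)^(-|w|)`. The probability that all copies fail is at most the product of the individual failure
probabilities (`updateLaw_noneFollowsAfter_le`), hence at most `1/2` for large `m`. Waiting `2T`
rounds rather than `T` makes up for this `1/2` in the expectation.

The word treats the paths one at a time and keeps the profile of a path symmetric, with outer values
`1 - δb, b` and `b, 1 - δb`. It starts at `b = 1`, where `2δ > 1` keeps the middle agent out. While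
that agent is inactive, a round of revisions sends `b` to `1 - δ + δ²b`, which contracts to the
stable equilibrium `1/(1 + δ)`; since `2δ/(1 + δ) < 1`, the middle agent eventually wants to enter
(`exists_pathRun_building`). Once it is active, a round sends `b` to `1 - 2δ + 3δ²b`. As `3δ² > 1`,
the fixed point of this map repels, and `b` starts below it, so `b` is driven down until agent `3`
drops out (`exists_pathRun_collapse`). The next path is then cut off from this one and still at
zero, and the procedure repeats. -/

noncomputable section
namespace NetworkGame
open MeasureTheory

/-! ### Words of revisions and their behaviour under the first step. -/

section Words

variable {C F : Type*} [Fintype C] [DecidableEq C] [Fintype F] [DecidableEq F]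

/-- The sequence that starts with `v` and continues with `ω`. -/
def consSeq {V : Type*} (v : V) (ω : ℕ → V) : ℕ → V
  | 0 => v
  | t + 1 => ω t

/-- The revisions of copy `c` in the sequence `ω` begin with the word `l`. -/
def Follows (c : C) : List F → (ℕ → C × F) → Prop
  | [], _ => True
  | a :: l, ω => ∃ t, (∀ s < t, (ω s).1 ≠ c) ∧ ω t = (c, a) ∧ Follows c l fun k => ω (t + 1 + k)

omit [Fintype C] [DecidableEq C] [Fintype F] [DecidableEq F] in
theorem follows_consSeq_of_ne {c c' : C} (h : c' ≠ c) (a : F) (l : List F) (ω : ℕ → C × F) :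
    Follows c l (consSeq (c', a) ω) ↔ Follows c l ω := by
  cases l with
  | nil => simp [Follows]
  | cons b l =>
    constructor
    · rintro ⟨t, h1, h2, h3⟩
      cases t with
      | zero => exact absurd (congrArg Prod.fst h2) h
      | succ t =>
        refine ⟨t, fun s hs => h1 (s + 1) (by omega), h2, ?_⟩
        convert h3 using 2 with k
        rw [show t + 1 + 1 + k = (t + 1 + k) + 1 by ring]; rfl
    · rintro ⟨t, h1, h2, h3⟩
      refine ⟨t + 1, fun s hs => ?_, h2, ?_⟩
      · cases s with
        | zero => exact h
        | succ s => exact h1 s (by omega)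
      · convert h3 using 2 with k
        rw [show t + 1 + 1 + k = (t + 1 + k) + 1 by ring]; rfl

omit [Fintype C] [DecidableEq C] [Fintype F] [DecidableEq F] in
theorem follows_cons_consSeq (c : C) (a b : F) (l : List F) (ω : ℕ → C × F) :
    Follows c (b :: l) (consSeq (c, a) ω) ↔ a = b ∧ Follows c l ω := by
  have key : (fun k => consSeq (c, a) ω (0 + 1 + k)) = ω := by
    funext k
    rw [show 0 + 1 + k = k + 1 by ring]; rfl
  constructor
  · rintro ⟨t, h1, h2, h3⟩
    cases t with
    | zero => exact ⟨congrArg Prod.snd h2, key ▸ h3⟩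
    | succ t => exact absurd rfl (h1 0 (by omega))
  · rintro ⟨rfl, h⟩
    exact ⟨0, by simp, rfl, key.symm ▸ h⟩

/-- What remains of a word after the letter `a`, `none` if it does not begin with `a`. -/
def remaining : Option (List F) → F → Option (List F)
  | none, _ => none
  | some [], _ => some []
  | some (b :: l), a => if a = b then some l else none

/-- The probability that a uniformly random sequence begins with a given word. -/
def wordProb (F : Type*) [Fintype F] : Option (List F) → ℝ
  | none => 0
  | some l => (1 / (Fintype.card F : ℝ)) ^ l.length

/-- No copy `c` follows its word `P c`. -/
def NoneFollows (P : C → Option (List F)) : Set (ℕ → C × F) :=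
  {ω | ∀ c, ∀ l, P c = some l → ¬ Follows c l ω}

-- First-step decomposition: a revision in copy `c` uses up one letter of the word of `c` and leaves
-- all other words alone.
omit [Fintype C] [Fintype F] in
theorem consSeq_mem_noneFollows (P : C → Option (List F)) (c : C) (a : F) (ω : ℕ → C × F) :
    consSeq (c, a) ω ∈ NoneFollows P ↔
      ω ∈ NoneFollows (Function.update P c (remaining (P c) a)) := by
  refine forall_congr' fun c' => ?_
  by_cases h : c' = c
  · subst h
    rw [Function.update_self]
    rcases hP : P c' with _ | ⟨_ | ⟨b, l⟩⟩
    · simp [remaining]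
    · simp [remaining, Follows]
    · by_cases hab : a = b
      · simp [remaining, hab, follows_cons_consSeq]
      · simp [remaining, hab, follows_cons_consSeq]
  · rw [Function.update_of_ne h]
    simp only [follows_consSeq_of_ne (Ne.symm h)]

omit [DecidableEq F] in
theorem wordProb_le_one (o : Option (List F)) : wordProb F o ≤ 1 := by
  rcases o with _ | l
  · simp [wordProb]
  · refine pow_le_one₀ (by positivity) ?_
    rcases Nat.eq_zero_or_pos (Fintype.card F) with h | h
    · simp [h]
    · rw [div_le_one (by positivity)]
      exact_mod_cast h

/-- Martingale property: the success probability is the average of its values after one uniformly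
random letter. -/
theorem sum_wordProb_remaining [Nonempty F] (o : Option (List F)) :
    ∑ a, wordProb F (remaining o a) = Fintype.card F * wordProb F o := by
  have hF : (Fintype.card F : ℝ) ≠ 0 := by exact_mod_cast Fintype.card_ne_zero
  rcases o with _ | ⟨_ | ⟨b, l⟩⟩
  · simp [remaining, wordProb]
  · simp [remaining, wordProb]
  · have : ∀ a : F, wordProb F (remaining (some (b :: l)) a) =
        if a = b then wordProb F (some l) else 0 := by
      intro a
      by_cases h : a = b <;> simp [remaining, h, wordProb]
    simp only [this, Finset.sum_ite_eq', Finset.mem_univ, if_true]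
    simp only [wordProb, List.length_cons, pow_succ]
    field_simp

end Words

/-! ### First-step analysis for the i.i.d. uniform law. -/

section Law

variable {V : Type*} [Fintype V] [Nonempty V] [MeasurableSpace V] [MeasurableSingletonClass V]

instance : IsProbabilityMeasure (updateLaw V) := by
  unfold updateLaw; infer_instance

omit [Fintype V] [Nonempty V] [MeasurableSingletonClass V] in
theorem measurable_consSeq : Measurable fun p : V × (ℕ → V) => consSeq p.1 p.2 := by
  refine measurable_pi_lambda _ fun t => ?_
  cases t with
  | zero => exact measurable_fst
  | succ t => exact (measurable_pi_apply t).comp measurable_snd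

omit [MeasurableSingletonClass V] in
theorem map_consSeq_updateLaw :
    ((PMF.uniformOfFintype V).toMeasure.prod (updateLaw V)).map
      (fun p => consSeq p.1 p.2) = updateLaw V := by
  classical
  refine Measure.eq_infinitePi _ fun s t ht => ?_
  -- Padding with `Set.univ` makes the cylinder depend on an initial segment of times, so that its
  -- first coordinate can be split off.
  set u : ℕ → Set V := fun i => if i ∈ s then t i else Set.univ with hu
  have hum : ∀ i, MeasurableSet (u i) := fun i => by
    by_cases h : i ∈ s
    · simpa [hu, h] using ht i
    · simp [hu, h]
  obtain ⟨N, hN⟩ : ∃ N, s ⊆ Finset.range (N + 1) :=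
    ⟨s.sup id, fun i hi => Finset.mem_range.2 (Nat.lt_succ_of_le (Finset.le_sup (f := id) hi))⟩
  have hset : Set.pi (s : Set ℕ) t = Set.pi (Finset.range (N + 1) : Set ℕ) u := by
    ext x
    simp only [Set.mem_pi, Finset.mem_coe]
    constructor
    · intro h i _
      by_cases his : i ∈ s
      · simpa [hu, his] using h i his
      · simp [hu, his]
    · intro h i hi
      simpa [hu, hi] using h i (hN hi)
  have hprod : ∏ i ∈ s, (PMF.uniformOfFintype V).toMeasure (t i) =
      ∏ i ∈ Finset.range (N + 1), (PMF.uniformOfFintype V).toMeasure (u i) := by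
    rw [← Finset.prod_subset hN fun i _ hi => by simp [hu, hi]]
    exact Finset.prod_congr rfl fun i hi => by simp [hu, hi]
  have hpre : (fun p : V × (ℕ → V) => consSeq p.1 p.2) ⁻¹'
      Set.pi (Finset.range (N + 1) : Set ℕ) u =
      u 0 ×ˢ Set.pi (Finset.range N : Set ℕ) fun i => u (i + 1) := by
    ext ⟨v, ω⟩
    simp only [Set.mem_preimage, Set.mem_pi, Finset.mem_coe, Finset.mem_range, Set.mem_prod]
    constructor
    · intro h
      exact ⟨h 0 (by omega), fun i hi => h (i + 1) (by omega)⟩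
    · rintro ⟨h0, h⟩ i hi
      cases i with
      | zero => exact h0
      | succ i => exact h i (by omega)
  rw [hset, hprod, Measure.map_apply measurable_consSeq
    (MeasurableSet.pi (Finset.countable_toSet _) fun i _ => hum i), hpre, Measure.prod_prod,
    updateLaw, Measure.infinitePi_pi _ fun i _ => hum (i + 1), Finset.prod_range_succ', mul_comm]

theorem card_mul_updateLaw_real {A : Set (ℕ → V)} (hA : MeasurableSet A) :
    Fintype.card V * (updateLaw V).real A = ∑ v, (updateLaw V).real {ω | consSeq v ω ∈ A} := by
  have hcard : (Fintype.card V : ℝ≥0∞) ≠ 0 := by simp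
  have h : (Fintype.card V : ℝ≥0∞) * updateLaw V A =
      ∑ v, updateLaw V {ω | consSeq v ω ∈ A} := by
    conv_lhs => rw [← map_consSeq_updateLaw, Measure.map_apply measurable_consSeq hA,
      Measure.prod_apply (measurable_consSeq hA), lintegral_fintype]
    rw [Finset.mul_sum]
    refine Finset.sum_congr rfl fun v _ => ?_
    rw [PMF.toMeasure_apply_singleton _ _ (measurableSet_singleton v),
      PMF.uniformOfFintype_apply, mul_comm, mul_assoc,
      ENNReal.inv_mul_cancel hcard (ENNReal.natCast_ne_top _), mul_one]
    rfl
  have h' := congrArg ENNReal.toReal h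
  rw [ENNReal.toReal_mul, ENNReal.toReal_natCast,
    ENNReal.toReal_sum fun v _ => measure_ne_top _ _] at h'
  exact h'

end Law

/-! ### Measurability of the word events. -/

section Measurability

variable {C F : Type*} [MeasurableSpace C] [MeasurableSpace F] [MeasurableSingletonClass C]
  [MeasurableSingletonClass F]

theorem measurableSet_follows (c : C) (l : List F) : MeasurableSet {ω | Follows c l ω} := by
  induction l with
  | nil => simp [Follows]
  | cons a l ih =>
    have : {ω : ℕ → C × F | Follows c (a :: l) ω} = ⋃ t, (⋂ s, ⋂ (_ : s < t),
        (fun ω : ℕ → C × F => (ω s).1) ⁻¹' {c}ᶜ) ∩ ((fun ω : ℕ → C × F => ω t) ⁻¹' {(c, a)} ∩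
        (fun ω : ℕ → C × F => fun k => ω (t + 1 + k)) ⁻¹' {ω | Follows c l ω}) := by
      ext ω
      simp [Follows]
    rw [this]
    refine MeasurableSet.iUnion fun t => (MeasurableSet.iInter fun s => MeasurableSet.iInter
      fun _ => ?_).inter (MeasurableSet.inter ?_ ?_)
    · exact (measurable_fst.comp (measurable_pi_apply s)) (measurableSet_singleton c).compl
    · exact measurable_pi_apply t (measurableSet_singleton _)
    · exact (measurable_pi_lambda _ fun k => measurable_pi_apply _) ih

theorem measurableSet_noneFollows [Countable C] (P : C → Option (List F)) :
    MeasurableSet (NoneFollows P) := by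
  have : NoneFollows P = ⋂ c, {ω | ∀ l, P c = some l → ¬ Follows c l ω} := by
    ext ω; simp [NoneFollows]
  rw [this]
  refine MeasurableSet.iInter fun c => ?_
  rcases P c with _ | l
  · simp
  · simpa [Set.compl_def] using (measurableSet_follows c l).compl

end Measurability

/-! ### Product bounds for the probability that every copy fails. -/

theorem pow_add_mul_le_add_pow {A ε : ℝ} (hA : 0 ≤ A) (hε : 0 ≤ ε) (k : ℕ) :
    A ^ k + k * (ε * A ^ (k - 1)) ≤ (A + ε) ^ k := by
  induction k with
  | zero => simp
  | succ k ih =>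
    have h1 := mul_le_mul_of_nonneg_right ih (add_nonneg hA hε)
    have h2 : (k : ℝ) * A ^ (k - 1) * A = k * A ^ k := by
      cases k with
      | zero => simp
      | succ k => simp only [Nat.add_sub_cancel]; ring
    have h3 : 0 ≤ (k : ℝ) * (ε * A ^ (k - 1)) * ε := by positivity
    rw [pow_succ (A + ε), pow_succ A, Nat.add_sub_cancel]
    push_cast
    nlinarith [congrArg (ε * ·) h2]

section Bounds

variable {C F : Type*} [Fintype C] [DecidableEq C] [Nonempty C] [Fintype F] [DecidableEq F]
  [Nonempty F] [MeasurableSpace C] [MeasurableSpace F] [MeasurableSingletonClass C]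
  [MeasurableSingletonClass F]

theorem card_mul_noneFollows (P : C → Option (List F)) :
    Fintype.card C * Fintype.card F * (updateLaw (C × F)).real (NoneFollows P) =
      ∑ c, ∑ a, (updateLaw (C × F)).real
        (NoneFollows (Function.update P c (remaining (P c) a))) := by
  have h := card_mul_updateLaw_real (measurableSet_noneFollows P)
  rw [Fintype.card_prod, Nat.cast_mul, Fintype.sum_prod_type] at h
  rw [h]
  refine Finset.sum_congr rfl fun c _ => Finset.sum_congr rfl fun a _ => ?_
  congr 1
  ext ω
  exact consSeq_mem_noneFollows P c a ω

/-- The product on the right satisfies the same first-step equation as the left side. Induction on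
the total number of letters left handles steps in copies with a nonempty word; steps in the other
copies leave `P` unchanged and cancel from the equation. -/
theorem updateLaw_noneFollows_le (P : C → Option (List F)) :
    (updateLaw (C × F)).real (NoneFollows P) ≤ ∏ c, (1 - wordProb F (P c)) := by
  suffices H : ∀ N, ∀ P : C → Option (List F), ∑ c, ((P c).getD []).length = N →
      (updateLaw (C × F)).real (NoneFollows P) ≤ ∏ c, (1 - wordProb F (P c)) from H _ P rfl
  intro N
  induction N using Nat.strong_induction_on with
  | _ N ih =>
  intro P hP
  have hF : (0 : ℝ) < Fintype.card F := by exact_mod_cast Fintype.card_pos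
  by_cases hD : ∃ c b l, P c = some (b :: l)
  -- If the bound failed, every copy with letters left would contribute strictly less than its share
  -- `|F| u` to the first-step equation, and every other copy exactly its share: a contradiction.
  · by_contra! hlt
    set u := (updateLaw (C × F)).real (NoneFollows P) with hu
    have key := card_mul_noneFollows P
    have hdec : ∀ c b l, P c = some (b :: l) →
        ∑ a, (updateLaw (C × F)).real (NoneFollows (Function.update P c (remaining (P c) a))) <
          Fintype.card F * u := by
      intro c b l hc
      refine lt_of_le_of_lt ?_ (mul_lt_mul_of_pos_left hlt hF)
      have h1 : ∀ a, (updateLaw (C × F)).real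
          (NoneFollows (Function.update P c (remaining (P c) a))) ≤
          (1 - wordProb F (remaining (P c) a)) *
            ∏ c' ∈ Finset.univ.erase c, (1 - wordProb F (P c')) := by
        intro a
        refine (ih _ ?_ (Function.update P c (remaining (P c) a)) rfl).trans_eq ?_
        · rw [← hP]
          refine Finset.sum_lt_sum (fun c' _ => ?_) ⟨c, Finset.mem_univ _, ?_⟩
          · by_cases h : c' = c
            · subst h
              rw [Function.update_self, hc]
              by_cases hab : a = b <;> simp [remaining, hab]
            · rw [Function.update_of_ne h]
          · rw [Function.update_self, hc]
            by_cases hab : a = b <;> simp [remaining, hab]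
        · rw [← Finset.mul_prod_erase _ _ (Finset.mem_univ c), Function.update_self]
          congr 1
          exact Finset.prod_congr rfl fun c' hc' => by
            rw [Function.update_of_ne (Finset.ne_of_mem_erase hc')]
      refine (Finset.sum_le_sum fun a _ => h1 a).trans_eq ?_
      rw [← Finset.sum_mul, Finset.sum_sub_distrib, sum_wordProb_remaining,
        ← Finset.mul_prod_erase _ _ (Finset.mem_univ c)]
      simp only [Finset.sum_const, Finset.card_univ, nsmul_eq_mul]
      ring
    have hle : ∀ c,
        ∑ a, (updateLaw (C × F)).real (NoneFollows (Function.update P c (remaining (P c) a))) ≤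
          Fintype.card F * u := by
      intro c
      rcases hc : P c with _ | ⟨_ | ⟨b, l⟩⟩
      · simp [remaining, ← hc, hu]
      · simp [remaining, ← hc, hu]
      · rw [← hc]
        exact (hdec c b l hc).le
    obtain ⟨c, b, l, hc⟩ := hD
    have := Finset.sum_lt_sum (fun c _ => hle c) ⟨c, Finset.mem_univ c, hdec c b l hc⟩
    rw [← key, Finset.sum_const, Finset.card_univ, nsmul_eq_mul] at this
    linarith
  · push Not at hD
    by_cases hs : ∃ c, P c = some []
    · obtain ⟨c, hc⟩ := hs
      have : NoneFollows P = ∅ := by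
        ext ω
        simp only [NoneFollows, Set.mem_ofPred_eq, Set.mem_empty_iff_false, iff_false, not_forall]
        exact ⟨c, [], hc, by simp [Follows]⟩
      rw [this, measureReal_empty]
      exact Finset.prod_nonneg fun c _ => sub_nonneg.2 (wordProb_le_one _)
    · push Not at hs
      have hnone : ∀ c, P c = none := fun c => by
        rcases hc : P c with _ | ⟨_ | ⟨b, l⟩⟩
        · rfl
        · exact absurd hc (hs c)
        · exact absurd hc (hD c b l)
      simp only [hnone, wordProb, sub_zero, Finset.prod_const_one]
      exact measureReal_le_one

/-- No copy in `K` stays unrevised before time `N` and then follows the word `w`. -/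
def NoneFollowsAfter (K : Finset C) (N : ℕ) (w : List F) : Set (ℕ → C × F) :=
  {ω | ∀ c ∈ K, ¬ ((∀ t < N, (ω t).1 ≠ c) ∧ Follows c w fun k => ω (N + k))}

omit [Fintype C] [DecidableEq C] [Nonempty C] [Fintype F] [DecidableEq F] [Nonempty F] in
theorem measurableSet_noneFollowsAfter (K : Finset C) (N : ℕ) (w : List F) :
    MeasurableSet (NoneFollowsAfter K N w) := by
  have : NoneFollowsAfter K N w = ⋂ c ∈ K, ((⋂ t, ⋂ (_ : t < N),
      (fun ω : ℕ → C × F => (ω t).1) ⁻¹' {c}ᶜ) ∩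
      (fun ω : ℕ → C × F => fun k => ω (N + k)) ⁻¹' {ω | Follows c w ω})ᶜ := by
    ext ω
    simp [NoneFollowsAfter]
  rw [this]
  refine Finset.measurableSet_biInter K fun c _ => MeasurableSet.compl ?_
  refine (MeasurableSet.iInter fun t => MeasurableSet.iInter fun _ => ?_).inter ?_
  · exact (measurable_fst.comp (measurable_pi_apply t)) (measurableSet_singleton c).compl
  · exact (measurable_pi_lambda _ fun k => measurable_pi_apply _) (measurableSet_follows c w)

omit [Fintype C] [Nonempty C] [Fintype F] [DecidableEq F] [Nonempty F] [MeasurableSpace C]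
  [MeasurableSpace F] [MeasurableSingletonClass C] [MeasurableSingletonClass F] in
theorem consSeq_mem_noneFollowsAfter (K : Finset C) (N : ℕ) (w : List F) (c : C) (a : F)
    (ω : ℕ → C × F) :
    consSeq (c, a) ω ∈ NoneFollowsAfter K (N + 1) w ↔ ω ∈ NoneFollowsAfter (K.erase c) N w := by
  have hshift : (fun k => consSeq (c, a) ω (N + 1 + k)) = fun k => ω (N + k) := by
    funext k
    rw [show N + 1 + k = (N + k) + 1 by ring]; rfl
  simp only [NoneFollowsAfter, Set.mem_ofPred_eq, hshift, Finset.mem_erase]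
  constructor
  · rintro h c' ⟨hne, hK⟩ ⟨h1, h2⟩
    refine h c' hK ⟨fun t ht => ?_, h2⟩
    cases t with
    | zero => exact hne.symm
    | succ t => exact h1 t (by omega)
  · rintro h c' hK ⟨h1, h2⟩
    exact h c' ⟨(h1 0 (by omega)).symm, hK⟩ ⟨fun t ht => h1 (t + 1) (by omega), h2⟩

theorem updateLaw_noneFollowsAfter_le (w : List F) (N : ℕ) (K : Finset C) :
    (updateLaw (C × F)).real (NoneFollowsAfter K N w) ≤
      (1 - (1 / (Fintype.card F : ℝ)) ^ w.length * (1 - 1 / Fintype.card C) ^ N) ^ K.card := by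
  have hF : (0 : ℝ) < Fintype.card F := by exact_mod_cast Fintype.card_pos
  have hC : (0 : ℝ) < Fintype.card C := by exact_mod_cast Fintype.card_pos
  have hC1 : (1 : ℝ) ≤ Fintype.card C := by exact_mod_cast Fintype.card_pos (α := C)
  induction N generalizing K with
  | zero =>
    have : NoneFollowsAfter K 0 w = NoneFollows fun c => if c ∈ K then some w else none := by
      ext ω
      simp [NoneFollowsAfter, NoneFollows]
    rw [this]
    refine (updateLaw_noneFollows_le _).trans_eq ?_
    have h : ∀ c, (1 : ℝ) - wordProb F (if c ∈ K then some w else none) =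
        if c ∈ K then 1 - (1 / (Fintype.card F : ℝ)) ^ w.length else 1 := by
      intro c
      by_cases hc : c ∈ K <;> simp [hc, wordProb]
    simp only [h]
    rw [Finset.prod_ite_mem]
    simp
  | succ N ih =>
    set q : ℝ := (1 / (Fintype.card F : ℝ)) ^ w.length * (1 - 1 / Fintype.card C) ^ N with hq
    have h1C : 0 ≤ 1 - 1 / (Fintype.card C : ℝ) := by
      rw [sub_nonneg, div_le_one hC]; exact hC1
    have hq0 : 0 ≤ q := by positivity
    have hq1 : q ≤ 1 := by
      refine mul_le_one₀ (wordProb_le_one (some w)) (by positivity) (pow_le_one₀ h1C ?_)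
      have : 0 ≤ 1 / (Fintype.card C : ℝ) := by positivity
      linarith
    have h := card_mul_updateLaw_real (measurableSet_noneFollowsAfter (C := C) K (N + 1) w)
    have h' : ∀ c a, {ω | consSeq (c, a) ω ∈ NoneFollowsAfter K (N + 1) w} =
        NoneFollowsAfter (K.erase c) N w := fun c a => by
      ext ω; exact consSeq_mem_noneFollowsAfter K N w c a ω
    rw [Fintype.card_prod, Nat.cast_mul, Fintype.sum_prod_type] at h
    simp only [h', Finset.sum_const, Finset.card_univ, nsmul_eq_mul, ← Finset.mul_sum] at h
    have h2 : (Fintype.card C : ℝ) * (updateLaw (C × F)).real (NoneFollowsAfter K (N + 1) w) =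
        ∑ c, (updateLaw (C × F)).real (NoneFollowsAfter (K.erase c) N w) := by
      refine mul_left_cancel₀ hF.ne' ?_
      rw [← h]; ring
    -- A first step inside `K` disqualifies one copy and lowers the exponent; a step outside `K`
    -- changes nothing.
    have h3 : ∑ c, (updateLaw (C × F)).real (NoneFollowsAfter (K.erase c) N w) ≤
        K.card * (1 - q) ^ (K.card - 1) + (Fintype.card C - K.card) * (1 - q) ^ K.card := by
      rw [← Finset.sum_add_sum_compl K]
      refine add_le_add ?_ ?_
      · refine (Finset.sum_le_card_nsmul _ _ _ fun c hc => ?_).trans_eq (nsmul_eq_mul _ _)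
        rw [← Finset.card_erase_of_mem hc]
        exact ih _
      · refine (Finset.sum_le_card_nsmul _ _ ((1 - q) ^ K.card) fun c hc => ?_).trans_eq ?_
        · rw [Finset.erase_eq_of_notMem (Finset.mem_compl.1 hc)]
          exact ih _
        · rw [nsmul_eq_mul, Finset.card_compl, Nat.cast_sub (Finset.card_le_univ _)]
    -- Divided by `|C|`, the bound `h3` is exactly the first two binomial terms of `(1 - q + q /
    -- |C|) ^ |K|`.
    have h4 := pow_add_mul_le_add_pow (sub_nonneg.2 hq1)
      (div_nonneg hq0 hC.le) K.card
    have h5 : 1 - (1 / (Fintype.card F : ℝ)) ^ w.length * (1 - 1 / (Fintype.card C : ℝ)) ^ (N + 1)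
        = 1 - q + q / Fintype.card C := by
      rw [hq, pow_succ]; ring
    rw [h5]
    refine le_trans ?_ h4
    rw [← mul_le_mul_iff_right₀ hC, h2]
    refine h3.trans_eq ?_
    rcases Nat.eq_zero_or_pos K.card with h0 | h0
    · simp [h0]
    · obtain ⟨k, hk⟩ := Nat.exists_eq_succ_of_ne_zero h0.ne'
      rw [hk]
      simp only [Nat.succ_eq_add_one, Nat.add_sub_cancel, pow_succ]
      field_simp
      ring

end Bounds

theorem eventually_one_sub_pow_le_half {q : ℝ} (hq : 0 < q) (hq1 : q ≤ 1) (E : ℕ) :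
    ∀ᶠ m : ℕ in Filter.atTop,
      (1 - q * (1 - 1 / (m : ℝ)) ^ (m * E)) ^ m ≤ (1 / 2 : ℝ) := by
  -- Half the limit of `(1 - 1/m)^(mE)`, hence a lower bound for it when `m` is large.
  set ρ : ℝ := (Real.exp (-1)) ^ E / 2 with hρ
  have hρ0 : 0 < ρ := by positivity
  have h1 : Filter.Tendsto (fun m : ℕ => ((1 + (-1) / (m : ℝ)) ^ m) ^ E) Filter.atTop
      (nhds (Real.exp (-1) ^ E)) := (Real.tendsto_one_add_div_pow_exp (-1)).pow E
  have hlt : ρ < Real.exp (-1) ^ E := by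
    have : 0 < Real.exp (-1) ^ E := by positivity
    rw [hρ]; linarith
  have hρ1 : ρ < 1 := hlt.trans_le (pow_le_one₀ (Real.exp_pos _).le (by simp))
  have h2 := h1.eventually (lt_mem_nhds hlt)
  have hqρ : 0 < q * ρ := by positivity
  have hqρ1 : q * ρ ≤ 1 := mul_le_one₀ hq1 hρ0.le hρ1.le
  have h3 := (tendsto_pow_atTop_nhds_zero_of_lt_one (r := 1 - q * ρ) (by linarith)
    (by linarith)).eventually (gt_mem_nhds (show (0 : ℝ) < 1 / 2 by norm_num))
  filter_upwards [h2, h3, Filter.eventually_ge_atTop 1] with m hm2 hm3 hm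
  have hm' : (1 : ℝ) ≤ m := by exact_mod_cast hm
  refine le_trans (pow_le_pow_left₀ ?_ ?_ m) hm3.le
  · have h0 : 0 ≤ 1 - 1 / (m : ℝ) := by
      rw [sub_nonneg, div_le_one (by linarith)]; exact hm'
    have h1 : 1 - 1 / (m : ℝ) ≤ 1 := by
      have : 0 ≤ 1 / (m : ℝ) := by positivity
      linarith
    have := mul_le_one₀ hq1 (by positivity) (pow_le_one₀ h0 h1 (n := m * E))
    linarith
  · have : (1 - 1 / (m : ℝ)) ^ (m * E) = ((1 + (-1) / (m : ℝ)) ^ m) ^ E := by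
      rw [pow_mul]; congr 2; ring
    rw [this]
    have := mul_le_mul_of_nonneg_left hm2.le hq.le
    linarith

/-! ### The dynamics on a single isolated path. -/

section Path

/-- One step of the best-response dynamics on the path with five vertices. -/
def pathStep (δ : ℝ) (q : Fin 5 → ℝ) (i : Fin 5) : Fin 5 → ℝ :=
  Function.update q i (bestResponse (SimpleGraph.pathGraph 5) δ q i)

/-- The revisions listed in the word lead from one profile to the other, and all profiles on the
way (including the first and the last one) have the property `J`. -/
inductive PathRun (δ : ℝ) (J : (Fin 5 → ℝ) → Prop) :
    (Fin 5 → ℝ) → List (Fin 5) → (Fin 5 → ℝ) → Prop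
  | nil {q} : J q → PathRun δ J q [] q
  | cons {q i l q'} : J q → PathRun δ J (pathStep δ q i) l q' → PathRun δ J q (i :: l) q'

variable {δ : ℝ} {J : (Fin 5 → ℝ) → Prop}

theorem PathRun.append {q q' q'' : Fin 5 → ℝ} {l l' : List (Fin 5)} (h : PathRun δ J q l q')
    (h' : PathRun δ J q' l' q'') : PathRun δ J q (l ++ l') q'' := by
  induction h with
  | nil _ => exact h'
  | cons hq _ ih => exact .cons hq (ih h')

theorem bestResponse_pathGraph_zero (a b c d e : ℝ) :
    bestResponse (SimpleGraph.pathGraph 5) δ ![a, b, c, d, e] 0 = max 0 (1 - δ * b) := by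
  simp [bestResponse, Fin.sum_univ_five, SimpleGraph.pathGraph_adj]

theorem bestResponse_pathGraph_one (a b c d e : ℝ) :
    bestResponse (SimpleGraph.pathGraph 5) δ ![a, b, c, d, e] 1 = max 0 (1 - δ * (a + c)) := by
  simp [bestResponse, Fin.sum_univ_five, SimpleGraph.pathGraph_adj]

theorem bestResponse_pathGraph_two (a b c d e : ℝ) :
    bestResponse (SimpleGraph.pathGraph 5) δ ![a, b, c, d, e] 2 = max 0 (1 - δ * (b + d)) := by
  simp [bestResponse, Fin.sum_univ_five, SimpleGraph.pathGraph_adj]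

theorem bestResponse_pathGraph_three (a b c d e : ℝ) :
    bestResponse (SimpleGraph.pathGraph 5) δ ![a, b, c, d, e] 3 = max 0 (1 - δ * (c + e)) := by
  simp [bestResponse, Fin.sum_univ_five, SimpleGraph.pathGraph_adj]

theorem bestResponse_pathGraph_four (a b c d e : ℝ) :
    bestResponse (SimpleGraph.pathGraph 5) δ ![a, b, c, d, e] 4 = max 0 (1 - δ * d) := by
  simp [bestResponse, Fin.sum_univ_five, SimpleGraph.pathGraph_adj]

theorem pathStep_zero {a b c d e : ℝ} (h : 0 ≤ 1 - δ * b) :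
    pathStep δ ![a, b, c, d, e] 0 = ![1 - δ * b, b, c, d, e] := by
  rw [pathStep, bestResponse_pathGraph_zero, max_eq_right h]
  ext i; fin_cases i <;> rfl

theorem pathStep_one {a b c d e : ℝ} (h : 0 ≤ 1 - δ * (a + c)) :
    pathStep δ ![a, b, c, d, e] 1 = ![a, 1 - δ * (a + c), c, d, e] := by
  rw [pathStep, bestResponse_pathGraph_one, max_eq_right h]
  ext i; fin_cases i <;> rfl

theorem pathStep_two {a b c d e : ℝ} (h : 0 ≤ 1 - δ * (b + d)) :
    pathStep δ ![a, b, c, d, e] 2 = ![a, b, 1 - δ * (b + d), d, e] := by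
  rw [pathStep, bestResponse_pathGraph_two, max_eq_right h]
  ext i; fin_cases i <;> rfl

theorem pathStep_three {a b c d e : ℝ} (h : 0 ≤ 1 - δ * (c + e)) :
    pathStep δ ![a, b, c, d, e] 3 = ![a, b, c, 1 - δ * (c + e), e] := by
  rw [pathStep, bestResponse_pathGraph_three, max_eq_right h]
  ext i; fin_cases i <;> rfl

theorem pathStep_four {a b c d e : ℝ} (h : 0 ≤ 1 - δ * d) :
    pathStep δ ![a, b, c, d, e] 4 = ![a, b, c, d, 1 - δ * d] := by
  rw [pathStep, bestResponse_pathGraph_four, max_eq_right h]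
  ext i; fin_cases i <;> rfl

/-- The middle agent is inactive and the other four agents of the path are active. -/
def Building (q : Fin 5 → ℝ) : Prop :=
  q 2 = 0 ∧ 0 < q 0 ∧ 0 < q 1 ∧ 0 < q 3 ∧ 0 < q 4

theorem building_vec {a b d e : ℝ} (ha : 0 < a) (hb : 0 < b) (hd : 0 < d) (he : 0 < e) :
    Building ![a, b, 0, d, e] :=
  ⟨rfl, ha, hb, hd, he⟩

theorem pathRun_init (hδ : δ ∈ Set.Ioo (0 : ℝ) 1) :
    PathRun δ (fun _ => True) ![0, 0, 0, 0, 0] [1, 3, 0, 4] ![1 - δ * 1, 1, 0, 1, 1 - δ * 1] := by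
  obtain ⟨h0, h1⟩ := hδ
  refine .cons trivial ?_
  rw [pathStep_one (by simp)]
  refine .cons trivial ?_
  rw [pathStep_three (by simp)]
  refine .cons trivial ?_
  rw [pathStep_zero (by simp; linarith)]
  refine .cons trivial ?_
  rw [pathStep_four (by simp; linarith)]
  simp only [add_zero, mul_zero, sub_zero]
  exact .nil trivial

/-- One round of revisions of the agents next to an inactive middle agent. -/
theorem pathRun_building (hδ : δ ∈ Set.Ioo (0 : ℝ) 1) {b : ℝ} (hb : 0 < b) (hb1 : b ≤ 1) :
    PathRun δ Building ![1 - δ * b, b, 0, b, 1 - δ * b] [1, 3, 0, 4]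
      ![1 - δ * (1 - δ * (1 - δ * b)), 1 - δ * (1 - δ * b), 0, 1 - δ * (1 - δ * b),
        1 - δ * (1 - δ * (1 - δ * b))] := by
  obtain ⟨h0, h1⟩ := hδ
  have hδb : 0 < δ * b := mul_pos h0 hb
  have ha : 0 < 1 - δ * b := by nlinarith
  have hb' : 0 < 1 - δ * (1 - δ * b) := by nlinarith
  have ha' : 0 < 1 - δ * (1 - δ * (1 - δ * b)) := by nlinarith [mul_pos h0 ha, mul_pos h0 hb']
  refine .cons (building_vec ha hb hb ha) ?_
  rw [pathStep_one (by simpa using hb'.le), add_zero]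
  refine .cons (building_vec ha hb' hb ha) ?_
  rw [pathStep_three (by simpa using hb'.le), zero_add]
  refine .cons (building_vec ha hb' hb' ha) ?_
  rw [pathStep_zero ha'.le]
  refine .cons (building_vec ha' hb' hb' ha) ?_
  rw [pathStep_four ha'.le]
  exact .nil (building_vec ha' hb' hb' ha')

theorem exists_pathRun_building (hδ : δ ∈ Set.Ioo (0 : ℝ) 1) {b : ℝ} (hb : 0 < b)
    (hb1 : b ≤ 1) :
    ∃ l b', 0 < b' ∧ b' ≤ 1 ∧ δ * (b' + b') < 1 ∧ PathRun δ Building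
      ![1 - δ * b, b, 0, b, 1 - δ * b] l ![1 - δ * b', b', 0, b', 1 - δ * b'] := by
  obtain ⟨h0, h1⟩ := id hδ
  -- The least drop of `b` in a round while `2δb ≥ 1`, attained at `2δb = 1`; `N` bounds the number
  -- of rounds needed.
  have hd : 0 < (1 - δ) ^ 2 / (2 * δ) := by
    have := sub_pos.2 h1
    positivity
  obtain ⟨N, hN⟩ := exists_nat_ge (b / ((1 - δ) ^ 2 / (2 * δ)))
  rw [div_le_iff₀ hd] at hN
  induction N generalizing b with
  | zero => simp at hN; linarith
  | succ N ih =>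
    by_cases hlt : δ * (b + b) < 1
    · have ha : 0 < 1 - δ * b := by nlinarith
      exact ⟨[], b, hb, hb1, hlt, .nil (building_vec ha hb hb ha)⟩
    · have ha : 0 < 1 - δ * b := by nlinarith
      have hdec : 1 - δ * (1 - δ * b) ≤ b - (1 - δ) ^ 2 / (2 * δ) := by
        have : (1 - δ) ^ 2 / (2 * δ) ≤ b - (1 - δ * (1 - δ * b)) := by
          rw [div_le_iff₀ (by positivity)]
          nlinarith [mul_nonneg (mul_nonneg (sub_nonneg.2 h1.le) (by linarith : 0 ≤ 1 + δ))
            (sub_nonneg.2 (not_lt.1 hlt))]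
        linarith
      push_cast at hN
      obtain ⟨l, b', h2, h3, h4, h5⟩ := ih (b := 1 - δ * (1 - δ * b)) (by nlinarith)
        (by nlinarith [mul_pos h0 ha]) (by linarith)
      exact ⟨_, b', h2, h3, h4, (pathRun_building hδ hb hb1).append h5⟩

/-- Once the middle agent is active, the agents next to it can be driven into inactivity. -/
theorem exists_pathRun_collapse (hδ : δ ∈ Set.Ioo (0 : ℝ) 1) (h3δ : 1 < 3 * δ ^ 2) {b : ℝ}
    (hb : 0 < b) (hlt : δ * (b + b) < 1) :
    ∃ l q', q' 3 = 0 ∧ PathRun δ (fun _ => True)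
      ![1 - δ * b, b, 1 - δ * (b + b), b, 1 - δ * b] l q' := by
  obtain ⟨h0, h1⟩ := id hδ
  have hd : 0 < (1 - δ) ^ 2 / (2 * δ) := by
    have := sub_pos.2 h1
    positivity
  obtain ⟨N, hN⟩ := exists_nat_ge (b / ((1 - δ) ^ 2 / (2 * δ)))
  rw [div_le_iff₀ hd] at hN
  induction N generalizing b with
  | zero => simp at hN; linarith
  | succ N ih =>
    set b' := 1 - δ * (1 - δ * b + (1 - δ * (b + b))) with hb'
    have hb'' : 1 - δ * (1 - δ * (b + b) + (1 - δ * b)) = b' := by rw [hb']; ring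
    -- Here `b - b' = 2δ - 1 - (3δ² - 1)b`, which decreases in `b`; its value at `b = 1/(2δ)` is the
    -- constant.
    have hdec : b' ≤ b - (1 - δ) ^ 2 / (2 * δ) := by
      have : (1 - δ) ^ 2 / (2 * δ) ≤ b - b' := by
        rw [div_le_iff₀ (by positivity)]
        nlinarith [mul_nonneg (sub_nonneg.2 h3δ.le) (sub_nonneg.2 hlt.le)]
      linarith
    by_cases hpos : 0 < b'
    · have hδb : 0 < δ * b' := mul_pos h0 hpos
      have hlt' : δ * (b' + b') < 1 := by nlinarith
      push_cast at hN
      obtain ⟨l, q', h2, h3⟩ := ih hpos hlt' (by linarith)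
      refine ⟨1 :: 3 :: 0 :: 4 :: 2 :: l, q', h2, .cons trivial ?_⟩
      rw [pathStep_one hpos.le]
      refine .cons trivial ?_
      rw [pathStep_three (hb''.symm ▸ hpos.le), hb'']
      refine .cons trivial ?_
      rw [pathStep_zero (by linarith)]
      refine .cons trivial ?_
      rw [pathStep_four (by linarith)]
      refine .cons trivial ?_
      rw [pathStep_two (by linarith)]
      exact h3
    · refine ⟨[3], _, ?_, .cons trivial (.nil trivial)⟩
      rw [pathStep, bestResponse_pathGraph_three, Function.update_self, hb'']
      exact max_eq_left (not_lt.1 hpos)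

end Path

/-- The golden ratio enters only through these inequalities: the first keeps the middle agent out
initially, the second drives the collapse. -/
theorem one_lt_of_goldenRatio_inv_lt {δ : ℝ} (h : 1 / Real.goldenRatio < δ) :
    1 < 2 * δ ∧ 1 < 3 * δ ^ 2 := by
  have h5 : Real.sqrt 5 < 2.4 := by
    rw [Real.sqrt_lt' (by norm_num)]; norm_num
  have hφ : Real.goldenRatio < 1.7 := by
    rw [Real.goldenRatio]; linarith
  have : (1 / 1.7 : ℝ) < δ :=
    (one_div_lt_one_div_of_lt Real.goldenRatio_pos hφ).trans h
  norm_num at this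
  constructor <;> nlinarith

/-! ### Stability of matchings. -/

section PosDef

open Classical in
/-- If all degrees are at most one, then `1 + δ A` is positive definite for all `δ ∈ (0, 1)`. -/
theorem posDef_one_add_smul_adjMatrix {W : Type*} [Fintype W] (H : SimpleGraph W)
    (hH : ∀ u v v', H.Adj u v → H.Adj u v' → v = v') {δ : ℝ} (hδ : δ ∈ Set.Ioo (0 : ℝ) 1) :
    (1 + δ • H.adjMatrix ℝ).PosDef := by
  rw [Matrix.posDef_iff_dotProduct_mulVec]
  refine ⟨?_, fun x hx => ?_⟩
  · refine Matrix.isHermitian_one.add ?_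
    ext u v
    simp [SimpleGraph.adj_comm]
  · have hdeg : ∀ u, ∑ v, (if H.Adj u v then (1 : ℝ) else 0) ≤ 1 := by
      intro u
      rw [Finset.sum_boole]
      have : (Finset.univ.filter fun v => H.Adj u v).card ≤ 1 :=
        Finset.card_le_one.2 fun v hv v' hv' => hH u v v' (by simpa using hv) (by simpa using hv')
      exact_mod_cast this
    have hquad : star x ⬝ᵥ ((1 + δ • H.adjMatrix ℝ).mulVec x) =
        ∑ u, x u ^ 2 + δ * ∑ u, ∑ v, (if H.Adj u v then 1 else 0) * (x u * x v) := by
      simp only [Matrix.add_mulVec, Matrix.one_mulVec, Matrix.smul_mulVec, dotProduct_add,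
        dotProduct_smul, smul_eq_mul, star_trivial]
      congr 1
      · simp [dotProduct, sq]
      · congr 1
        simp only [dotProduct, Matrix.mulVec, Finset.mul_sum, SimpleGraph.adjMatrix_apply]
        exact Finset.sum_congr rfl fun u _ => Finset.sum_congr rfl fun v _ => by ring
    have hsym : ∑ u, ∑ v, (if H.Adj u v then (1 : ℝ) else 0) * x v ^ 2 =
        ∑ u, ∑ v, (if H.Adj u v then (1 : ℝ) else 0) * x u ^ 2 := by
      rw [Finset.sum_comm]
      simp only [H.adj_comm]
    have hle : ∑ u, ∑ v, (if H.Adj u v then (1 : ℝ) else 0) * x u ^ 2 ≤ ∑ u, x u ^ 2 := by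
      refine Finset.sum_le_sum fun u _ => ?_
      rw [← Finset.sum_mul]
      exact mul_le_of_le_one_left (sq_nonneg _) (hdeg u)
    -- Sum `2xy ≥ -(x² + y²)` over adjacent pairs and use the degree bound.
    have hcross : -(∑ u, x u ^ 2) ≤
        ∑ u, ∑ v, (if H.Adj u v then (1 : ℝ) else 0) * (x u * x v) := by
      have : ∑ u, ∑ v, (if H.Adj u v then (1 : ℝ) else 0) * (-(x u ^ 2 + x v ^ 2) / 2) ≤
          ∑ u, ∑ v, (if H.Adj u v then (1 : ℝ) else 0) * (x u * x v) := by
        refine Finset.sum_le_sum fun u _ => Finset.sum_le_sum fun v _ =>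
          mul_le_mul_of_nonneg_left ?_ (by split_ifs <;> norm_num)
        nlinarith [sq_nonneg (x u + x v)]
      refine le_trans ?_ this
      have h : ∑ u, ∑ v, (if H.Adj u v then (1 : ℝ) else 0) * (-(x u ^ 2 + x v ^ 2) / 2) =
          -((∑ u, ∑ v, (if H.Adj u v then (1 : ℝ) else 0) * x u ^ 2) +
            ∑ u, ∑ v, (if H.Adj u v then (1 : ℝ) else 0) * x v ^ 2) / 2 := by
        simp only [← Finset.sum_add_distrib, neg_div, Finset.sum_div, ← Finset.sum_neg_distrib]
        exact Finset.sum_congr rfl fun u _ => Finset.sum_congr rfl fun v _ => by ring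
      rw [h, hsym]
      linarith
    have hpos : 0 < ∑ u, x u ^ 2 := by
      obtain ⟨u, hu⟩ := Function.ne_iff.1 hx
      exact Finset.sum_pos' (fun u _ => sq_nonneg _) ⟨u, Finset.mem_univ _, by
        have : x u ≠ 0 := hu
        positivity⟩
    rw [hquad]
    nlinarith [hδ.1, hδ.2]

end PosDef

/-! ### Paths isolated inside the chain. -/

section Chain

variable {m n : ℕ} {δ : ℝ}

/-- The path `j` of copy `c` has the profile `q` and is not influenced by the adjacent paths:
the agent linking the previous path to it and all agents of later paths are inactive. -/
def Shape (c : Fin m) (j : ℕ) (x : Fin m × Fin n × Fin 5 → ℝ) (q : Fin 5 → ℝ) : Prop :=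
  (∀ j' : Fin n, (j' : ℕ) = j → ∀ i, x (c, j', i) = q i) ∧
    (∀ j' : Fin n, (j' : ℕ) + 1 = j → x (c, j', 3) = 0) ∧
    ∀ j' : Fin n, j < j' → ∀ i, x (c, j', i) = 0

theorem Shape.congr {c : Fin m} {j : ℕ} {x x' : Fin m × Fin n × Fin 5 → ℝ} {q : Fin 5 → ℝ}
    (h : Shape c j x q) (hx : ∀ p, x' (c, p) = x (c, p)) : Shape c j x' q := by
  simpa only [Shape, hx] using h

/-- A path whose agent `3` is inactive does not influence the next path. -/
theorem Shape.next {c : Fin m} {j : ℕ} {x : Fin m × Fin n × Fin 5 → ℝ} {q : Fin 5 → ℝ}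
    (h : Shape c j x q) (hq : q 3 = 0) : Shape c (j + 1) x ![0, 0, 0, 0, 0] := by
  refine ⟨fun j' hj' i => ?_, fun j' hj' => ?_, fun j' hj' i => h.2.2 j' (by omega) i⟩
  · rw [h.2.2 j' (by omega) i]
    fin_cases i <;> rfl
  · rw [h.1 j' (by omega), hq]

theorem Shape.bestResponse_eq {c : Fin m} {j : Fin n} {x : Fin m × Fin n × Fin 5 → ℝ}
    {q : Fin 5 → ℝ} (h : Shape c j x q) (i : Fin 5) :
    bestResponse (chainedPaths m n) δ x (c, j, i) =
      bestResponse (SimpleGraph.pathGraph 5) δ q i := by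
  classical
  unfold bestResponse
  congr 3
  symm
  refine Fintype.sum_of_injective (fun i' : Fin 5 => (c, j, i')) (fun a b hab => by simpa using hab)
    _ _ ?_ ?_
  · rintro ⟨c', j', i'⟩ hnot
    split_ifs with hadj
    · obtain ⟨rfl, h1 | ⟨h1, h2, h3⟩ | ⟨h1, h2, h3⟩⟩ := hadj
      · exact absurd ⟨i', by rw [show j' = j from h1.1.symm]⟩ hnot
      · exact h.2.2 j' (by simp only at h1; omega) i'
      · simp only at h1 h2
        rw [h2]
        exact h.2.1 j' h1
    · rfl
  · intro i'
    have : (chainedPaths m n).Adj (c, j, i) (c, j, i') ↔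
        (SimpleGraph.pathGraph 5).Adj i i' := by
      simp [chainedPaths]
    simp only [this, h.1 j rfl]

theorem Shape.update {c : Fin m} {j : Fin n} {x : Fin m × Fin n × Fin 5 → ℝ}
    {q : Fin 5 → ℝ} (h : Shape c j x q) (i : Fin 5) :
    Shape c j (Function.update x (c, j, i) (bestResponse (chainedPaths m n) δ x (c, j, i)))
      (pathStep δ q i) := by
  refine ⟨fun j' hj' i' => ?_, fun j' hj' => ?_, fun j' hj' i' => ?_⟩
  · obtain rfl : j' = j := Fin.ext hj'
    by_cases hi : i' = i
    · subst hi
      rw [Function.update_self, pathStep, Function.update_self, h.bestResponse_eq]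
    · rw [Function.update_of_ne (by simpa using hi), pathStep, Function.update_of_ne hi, h.1 _ rfl]
  · rw [Function.update_of_ne (by rintro hh; simp at hh; omega), h.2.1 _ hj']
  · rw [Function.update_of_ne (by rintro hh; simp at hh; omega), h.2.2 _ hj']

/-- The agents of the path `j` of copy `c` except for the middle one. -/
def outerAgents (c : Fin m) (j : Fin n) : Set (Fin m × Fin n × Fin 5) :=
  {v | v.1 = c ∧ v.2.1 = j ∧ v.2.2 ≠ 2}

theorem Shape.mem_activeSet_iff {c : Fin m} {j : Fin n} {x : Fin m × Fin n × Fin 5 → ℝ}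
    {q : Fin 5 → ℝ} (h : Shape c j x q) (hq : Building q) (i : Fin 5) :
    (c, j, i) ∈ activeSet x ↔ i ≠ 2 := by
  obtain ⟨h2, h0, h1, h3, h4⟩ := hq
  simp only [activeSet, Set.mem_ofPred_eq, h.1 j rfl]
  fin_cases i <;> simp [h0, h1, h2, h3, h4]

/-- The edges leaving the path end at inactive agents, so the fragments are just the two outer edges
of the path. -/
theorem Shape.adjacentFragments_eq {c : Fin m} {j : Fin n} {x : Fin m × Fin n × Fin 5 → ℝ}
    {q : Fin 5 → ℝ} (h : Shape c j x q) (hq : Building q) :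
    adjacentFragments (chainedPaths m n) x (c, j, 2) = outerAgents c j := by
  have hclosed : ∀ v w, v ∈ outerAgents c j → (chainedPaths m n).Adj v w → w ∈ activeSet x →
      w ∈ outerAgents c j := by
    rintro ⟨c', j', i⟩ ⟨c'', j'', i'⟩ ⟨rfl, rfl, hi⟩ ⟨rfl, hadj⟩ hw
    simp only at hadj hw h
    rcases hadj with h1 | ⟨h1, h2, h3⟩ | ⟨h1, h2, h3⟩
    · obtain ⟨rfl, h1⟩ := h1
      exact ⟨rfl, rfl, (h.mem_activeSet_iff hq i').1 hw⟩
    · exact absurd (h.2.2 j'' (by omega) i') hw.ne'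
    · subst h2
      exact absurd (h.2.1 j'' h1) hw.ne'
  ext v
  constructor
  · rintro ⟨hv, k, hk, hadj, hreach⟩
    have hk' : k ∈ outerAgents c j := by
      obtain ⟨c', j', i⟩ := k
      obtain ⟨rfl, hadj⟩ := hadj
      simp only at hadj hk h
      rcases hadj with h1 | ⟨h1, h2, h3⟩ | ⟨h1, h2, h3⟩
      · obtain ⟨rfl, h1⟩ := h1
        exact ⟨rfl, rfl, (h.mem_activeSet_iff hq i).1 hk⟩
      · exact absurd h2 (by decide)
      · exact absurd h3 (by decide)
    obtain ⟨p⟩ := hreach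
    suffices H : ∀ (a b : activeSet x), ((chainedPaths m n).induce (activeSet x)).Walk a b →
        (a : Fin m × Fin n × Fin 5) ∈ outerAgents c j →
        (b : Fin m × Fin n × Fin 5) ∈ outerAgents c j from H _ _ p hk'
    intro a b p
    induction p with
    | nil => exact id
    | cons hab _ ih => exact fun ha => ih (hclosed _ _ ha hab (Subtype.prop _))
  · obtain ⟨c', j', i⟩ := v
    rintro ⟨rfl, rfl, hi⟩
    have hact : ∀ i, i ≠ 2 → (c', j', i) ∈ activeSet x := fun i hi =>
      (h.mem_activeSet_iff hq i).2 hi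
    have hpath : ∀ i i' : Fin 5, (SimpleGraph.pathGraph 5).Adj i i' →
        (chainedPaths m n).Adj (c', j', i) (c', j', i') := fun i i' hh => ⟨rfl, Or.inl ⟨rfl, hh⟩⟩
    have hreach : ∀ k i : Fin 5, k ≠ 2 → i ≠ 2 → (SimpleGraph.pathGraph 5).Adj 2 k →
        (k = i ∨ (SimpleGraph.pathGraph 5).Adj k i) →
        (c', j', i) ∈ adjacentFragments (chainedPaths m n) x (c', j', 2) := by
      intro k i hk hi h2 hki
      refine ⟨hact i hi, (c', j', k), hact k hk, hpath _ _ h2, ?_⟩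
      rcases hki with rfl | hki
      · rfl
      · exact SimpleGraph.Adj.reachable (hpath _ _ hki)
    fin_cases i
    · exact hreach 1 0 (by decide) (by decide) (by simp [SimpleGraph.pathGraph_adj])
        (by simp [SimpleGraph.pathGraph_adj])
    · exact hreach 1 1 (by decide) (by decide) (by simp [SimpleGraph.pathGraph_adj])
        (Or.inl rfl)
    · exact absurd rfl hi
    · exact hreach 3 3 (by decide) (by decide) (by simp [SimpleGraph.pathGraph_adj])
        (Or.inl rfl)
    · exact hreach 3 4 (by decide) (by decide) (by simp [SimpleGraph.pathGraph_adj])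
        (by simp [SimpleGraph.pathGraph_adj])

/-- The outer agents induce two disjoint edges, on each of which both agents play the solution `1/(1
+ δ)` of `e = 1 - δe`. -/
theorem exists_stableLocalEquilibrium (hδ : δ ∈ Set.Ioo (0 : ℝ) 1) (c : Fin m) (j : Fin n) :
    ∃ y, IsStableLocalEquilibrium (chainedPaths m n) δ (outerAgents c j) y ∧
      0 < bestResponse (chainedPaths m n) δ y (c, j, 2) := by
  classical
  obtain ⟨h0, h1⟩ := id hδ
  set e : ℝ := 1 / (1 + δ) with he
  have he0 : 0 < e := by positivity
  have hfix : 1 - δ * e = e := by rw [he]; field_simp; ring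
  set y : Fin m × Fin n × Fin 5 → ℝ := fun v => if v ∈ outerAgents c j then e else 0 with hy
  have hshape : Shape c j y ![e, e, 0, e, e] := by
    refine ⟨fun j' hj' i => ?_, fun j' hj' => ?_, fun j' hj' i => ?_⟩
    · obtain rfl : j' = j := Fin.ext hj'
      fin_cases i <;> simp [hy, outerAgents]
    · refine if_neg fun hh => ?_
      have : j' = j := hh.2.1
      omega
    · refine if_neg fun hh => ?_
      have : j' = j := hh.2.1
      omega
  refine ⟨y, ⟨?_, fun v hv => if_neg hv, ?_, ?_⟩, ?_⟩
  · ext v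
    by_cases hv : v ∈ outerAgents c j <;> simp [activeSet, hy, hv, he0]
  · rintro ⟨c', j', i⟩ ⟨rfl, rfl, hi⟩
    simp only at hshape hi ⊢
    rw [hshape.bestResponse_eq, hshape.1 j' rfl]
    fin_cases i
    · exact (bestResponse_pathGraph_zero ..).symm ▸ by simp [hfix, he0.le]
    · exact (bestResponse_pathGraph_one ..).symm ▸ by simp [hfix, he0.le]
    · exact absurd rfl hi
    · exact (bestResponse_pathGraph_three ..).symm ▸ by simp [hfix, he0.le]
    · exact (bestResponse_pathGraph_four ..).symm ▸ by simp [hfix, he0.le]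
  · have hmatch : ∀ u v v', ((chainedPaths m n).induce (outerAgents c j)).Adj u v →
        ((chainedPaths m n).induce (outerAgents c j)).Adj u v' → v = v' := by
      have hpath : ∀ a b b' : Fin 5, a ≠ 2 → b ≠ 2 → b' ≠ 2 → (SimpleGraph.pathGraph 5).Adj a b →
          (SimpleGraph.pathGraph 5).Adj a b' → b = b' := by
        simp only [SimpleGraph.pathGraph_adj]
        decide
      have hadj : ∀ u v : outerAgents c j,
          ((chainedPaths m n).induce (outerAgents c j)).Adj u v →
            (SimpleGraph.pathGraph 5).Adj u.1.2.2 v.1.2.2 := by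
        rintro ⟨⟨_, _, a⟩, rfl, rfl, ha⟩ ⟨⟨_, _, b⟩, hb1, hb2, hb⟩ ⟨_, h1 | h1 | h1⟩
        · exact h1.2
        · simp at hb2 h1
          have := congrArg Fin.val hb2
          omega
        · simp at hb2 h1
          have := congrArg Fin.val hb2
          omega
      intro u v v' hv hv'
      refine Subtype.ext (Prod.ext (v.2.1.trans v'.2.1.symm) (Prod.ext (v.2.2.1.trans
        v'.2.2.1.symm) (hpath _ _ _ u.2.2.2 v.2.2.2 v'.2.2.2 (hadj _ _ hv) (hadj _ _ hv'))))
    convert posDef_one_add_smul_adjMatrix _ hmatch hδ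
  · rw [hshape.bestResponse_eq, bestResponse_pathGraph_two]
    refine lt_max_of_lt_right ?_
    have : δ * e < e := by nlinarith
    linarith

end Chain

/-! ### From words to reshuffles of the full dynamics. -/

section Trajectory

variable {m n : ℕ} {δ : ℝ}

theorem trajectory_eq_of_ne {c : Fin m} {x₀ : Fin m × Fin n × Fin 5 → ℝ}
    {ω : ℕ → Fin m × Fin n × Fin 5} {s t : ℕ} (hst : s ≤ t)
    (h : ∀ r, s ≤ r → r < t → (ω r).1 ≠ c) (p : Fin n × Fin 5) :
    trajectory (chainedPaths m n) δ x₀ ω t (c, p) =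
      trajectory (chainedPaths m n) δ x₀ ω s (c, p) := by
  induction t, hst using Nat.le_induction with
  | base => rfl
  | succ t hst ih =>
    rw [trajectory, Function.update_of_ne, ih fun r h1 h2 => h r h1 (by omega)]
    exact fun hh => h t hst (by omega) (congrArg Prod.fst hh).symm

theorem exists_step_of_follows {c : Fin m} {x₀ : Fin m × Fin n × Fin 5 → ℝ}
    {ω : ℕ → Fin m × Fin n × Fin 5} {t : ℕ} {a : Fin n × Fin 5} {l : List (Fin n × Fin 5)}
    (h : Follows c (a :: l) fun k => ω (t + k)) :
    ∃ t', t ≤ t' ∧ (∀ r, t ≤ r → r ≤ t' → ∀ p, trajectory (chainedPaths m n) δ x₀ ω r (c, p) =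
        trajectory (chainedPaths m n) δ x₀ ω t (c, p)) ∧ ω t' = (c, a) ∧
      Follows c l fun k => ω (t' + 1 + k) := by
  obtain ⟨k, h1, h2, h3⟩ := h
  refine ⟨t + k, by omega, fun r hr hr' p => trajectory_eq_of_ne hr (fun r' h4 h5 => ?_) p, h2, ?_⟩
  · have := h1 (r' - t) (by omega)
    dsimp only at this
    rwa [Nat.add_sub_cancel' h4] at this
  · convert h3 using 3
    ring

/-- Transfers a run of the isolated path to the full dynamics: between consecutive letters the copy
is frozen, so `J` holds at all intermediate times as well. -/
theorem PathRun.exists_time {J : (Fin 5 → ℝ) → Prop} {q q' : Fin 5 → ℝ} {l : List (Fin 5)}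
    (h : PathRun δ J q l q') {c : Fin m} {j : Fin n} {x₀ : Fin m × Fin n × Fin 5 → ℝ}
    {ω : ℕ → Fin m × Fin n × Fin 5} {t : ℕ} {l' : List (Fin n × Fin 5)}
    (hx : Shape c j (trajectory (chainedPaths m n) δ x₀ ω t) q)
    (hf : Follows c (l.map (fun i => (j, i)) ++ l') fun k => ω (t + k)) :
    ∃ t', t ≤ t' ∧
      (∀ r, t ≤ r → r ≤ t' →
        ∃ q, J q ∧ Shape c j (trajectory (chainedPaths m n) δ x₀ ω r) q) ∧
      Shape c j (trajectory (chainedPaths m n) δ x₀ ω t') q' ∧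
      Follows c l' fun k => ω (t' + k) := by
  induction h generalizing t with
  | nil hq =>
    exact ⟨t, le_rfl, fun r h1 h2 => ⟨_, hq, le_antisymm h1 h2 ▸ hx⟩, hx, hf⟩
  | cons hq _ ih =>
    obtain ⟨t₁, h1, h2, h3, h4⟩ := exists_step_of_follows (δ := δ) (x₀ := x₀) hf
    have hx₁ := (hx.congr (h2 t₁ h1 le_rfl)).update (δ := δ)
    obtain ⟨t₂, h5, h6, h7, h8⟩ := ih (t := t₁ + 1) (by rw [trajectory, h3]; exact hx₁ _) h4
    refine ⟨t₂, by omega, fun r hr hr' => ?_, h7, h8⟩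
    rcases Nat.lt_or_ge t₁ r with h | h
    · exact h6 r h hr'
    · exact ⟨_, hq, hx.congr (h2 r hr h)⟩

/-- There is a word, not depending on the graph, such that whenever a path in its initial state
is revised according to this word, its middle agent undergoes a reshuffle and the next path is
left in its initial state. -/
theorem exists_reshuffle_word (hδ : δ ∈ Set.Ioo (0 : ℝ) 1) (h2δ : 1 < 2 * δ)
    (h3δ : 1 < 3 * δ ^ 2) :
    ∃ l : List (Fin 5), ∀ (m n : ℕ) (c : Fin m) (j : Fin n) (x₀ : Fin m × Fin n × Fin 5 → ℝ)
      (ω : ℕ → Fin m × Fin n × Fin 5) (t : ℕ) (l' : List (Fin n × Fin 5)),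
      Shape c j (trajectory (chainedPaths m n) δ x₀ ω t) ![0, 0, 0, 0, 0] →
      (Follows c (l.map (fun i => (j, i)) ++ l') fun k => ω (t + k)) →
      ∃ s₁ t₁ t', t ≤ s₁ ∧ t₁ < t' ∧
        IsReshuffle (chainedPaths m n) δ (trajectory (chainedPaths m n) δ x₀ ω) (c, j, 2) s₁ t₁ ∧
        Shape c (j + 1) (trajectory (chainedPaths m n) δ x₀ ω t') ![0, 0, 0, 0, 0] ∧
        Follows c l' fun k => ω (t' + k) := by
  obtain ⟨l₁, b, hb, hb1, hlt, hrun⟩ := exists_pathRun_building hδ zero_lt_one le_rfl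
  obtain ⟨l₂, q', hq', hrun'⟩ := exists_pathRun_collapse hδ h3δ hb hlt
  refine ⟨[1, 3, 0, 4] ++ (l₁ ++ 2 :: l₂), fun m n c j x₀ ω t l' hx hf => ?_⟩
  simp only [List.map_append, List.append_assoc] at hf
  obtain ⟨s₁, hs, -, hxs, hfs⟩ := (pathRun_init hδ).exists_time hx hf
  obtain ⟨t₀, ht₀, hbuild, hxt₀, hft₀⟩ := hrun.exists_time hxs hfs
  obtain ⟨t₁, ht₁, hconst, hω, hft₁⟩ := exists_step_of_follows (δ := δ) (x₀ := x₀) hft₀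
  have hxt₁ := hxt₀.congr (hconst t₁ ht₁ le_rfl)
  have hstep := hxt₁.update (δ := δ) 2
  rw [← hω, pathStep_two (by linarith)] at hstep
  obtain ⟨t', ht', -, hxt', hft'⟩ := hrun'.exists_time (t := t₁ + 1) hstep hft₁
  have hbuild' : ∀ r, s₁ ≤ r → r ≤ t₁ →
      ∃ q, Building q ∧ Shape c j (trajectory (chainedPaths m n) δ x₀ ω r) q := by
    intro r h1 h2
    rcases Nat.lt_or_ge t₀ r with h | h
    · obtain ⟨q, hq, hs⟩ := hbuild t₀ ht₀ le_rfl
      exact ⟨q, hq, hs.congr (hconst r h.le h2)⟩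
    · exact hbuild r h1 h
  -- Agent `1` plays `1` at time `s₁` but `b` at time `t₁`, and `2δb < 1 < 2δ`.
  have hne : s₁ ≠ t₁ := by
    rintro rfl
    have h1 : (1 : ℝ) = b := (hxs.1 j rfl 1).symm.trans (hxt₁.1 j rfl 1)
    rw [← h1] at hlt
    linarith
  refine ⟨s₁, t₁, t', hs, by omega, ⟨lt_of_le_of_ne (ht₀.trans ht₁) hne, outerAgents c j,
    ⟨(c, j, 0), rfl, rfl, show (0 : Fin 5) ≠ 2 by decide⟩, fun r h1 h2 => ?_, ?_,
    exists_stableLocalEquilibrium hδ c j, ?_⟩, hxt'.next hq', hft'⟩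
  · obtain ⟨q, hq, hs⟩ := hbuild' r h1 h2
    exact ⟨(hs.1 j rfl 2).trans hq.1, hs.adjacentFragments_eq hq⟩
  · rw [hxs.bestResponse_eq, bestResponse_pathGraph_two]
    exact max_eq_left (by linarith)
  · have : trajectory (chainedPaths m n) δ x₀ ω (t₁ + 1) (c, j, 2) = 1 - δ * (b + b) :=
      hstep.1 j rfl 2
    rw [this]
    linarith

/-- There is a word such that every copy that is revised according to this word, starting at
inactivity, undergoes a chain of reshuffles. -/
theorem exists_reshuffleChain_word (hδ : δ ∈ Set.Ioo (0 : ℝ) 1) (h2δ : 1 < 2 * δ)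
    (h3δ : 1 < 3 * δ ^ 2) (n : ℕ) [NeZero n] :
    ∃ w : List (Fin n × Fin 5), ∀ (m : ℕ) (c : Fin m) (ω : ℕ → Fin m × Fin n × Fin 5) (N : ℕ),
      (∀ t < N, (ω t).1 ≠ c) → (Follows c w fun k => ω (N + k)) →
      HasReshuffleChain m n δ (trajectory (chainedPaths m n) δ 0 ω) c N := by
  obtain ⟨l, hl⟩ := exists_reshuffle_word hδ h2δ h3δ
  have key : ∀ d j, j + d = n → ∃ w : List (Fin n × Fin 5), ∀ (m : ℕ) (c : Fin m)
      (ω : ℕ → Fin m × Fin n × Fin 5) (N : ℕ),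
      Shape c j (trajectory (chainedPaths m n) δ 0 ω N) ![0, 0, 0, 0, 0] →
      (Follows c w fun k => ω (N + k)) →
      ∃ s t : Fin n → ℕ, (∀ i : Fin n, j ≤ i → N ≤ s i ∧
        IsReshuffle (chainedPaths m n) δ (trajectory (chainedPaths m n) δ 0 ω) (c, i, 2)
          (s i) (t i)) ∧ ∀ i i' : Fin n, j ≤ i → i < i' → t i < s i' := by
    intro d
    induction d with
    | zero =>
      intro j hj
      exact ⟨[], fun m c ω N _ _ => ⟨0, 0, fun i hi => by omega, fun i i' hi => by omega⟩⟩
    | succ d ih =>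
      intro j hj
      obtain ⟨w, hw⟩ := ih (j + 1) (by omega)
      have hjn : j < n := by omega
      refine ⟨l.map (fun i => (⟨j, hjn⟩, i)) ++ w, fun m c ω N hx hf => ?_⟩
      obtain ⟨s₁, t₁, N', hN, hN', hresh, hx', hf'⟩ := hl m n c ⟨j, hjn⟩ 0 ω N w hx hf
      obtain ⟨s, t, hst, hlt⟩ := hw m c ω N' hx' hf'
      have hs₁ := hresh.1
      refine ⟨Function.update s ⟨j, hjn⟩ s₁, Function.update t ⟨j, hjn⟩ t₁, fun i hi => ?_,
        fun i i' hi hii' => ?_⟩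
      · by_cases h : i = ⟨j, hjn⟩
        · subst h
          simpa using ⟨hN, hresh⟩
        · rw [Function.update_of_ne h, Function.update_of_ne h]
          have h' : (i : ℕ) ≠ j := fun hh => h (Fin.ext hh)
          have := hst i (by omega)
          exact ⟨by omega, this.2⟩
      · have hi' : i' ≠ ⟨j, hjn⟩ := by
          rintro rfl
          exact absurd hii' (not_lt.2 hi)
        have h2 : (i : ℕ) < i' := hii'
        rw [Function.update_of_ne hi']
        by_cases h : i = ⟨j, hjn⟩
        · subst h
          rw [Function.update_self]
          have := (hst i' (by omega)).1
          omega
        · rw [Function.update_of_ne h]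
          have h' : (i : ℕ) ≠ j := fun hh => h (Fin.ext hh)
          exact hlt i i' (by omega) hii'
  obtain ⟨w, hw⟩ := key n 0 (by omega)
  refine ⟨w, fun m c ω N hN hf => ?_⟩
  have hzero : ∀ p, trajectory (chainedPaths m n) δ 0 ω N (c, p) = 0 := fun p =>
    trajectory_eq_of_ne (Nat.zero_le N) (fun r _ hr => hN r hr) p
  obtain ⟨s, t, hst, hlt⟩ := hw m c ω N ⟨fun j _ i => by rw [hzero]; fin_cases i <;> rfl,
    fun j _ => hzero _, fun j _ i => hzero _⟩ hf
  refine ⟨s, t, fun i => (hst i (Nat.zero_le _)).2, fun i i' h => hlt i i' (Nat.zero_le _) h,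
    0, ?_⟩
  have h := hst 0 (Nat.zero_le _)
  exact h.1.trans h.2.1.le

theorem HasReshuffleChain.mono {x : ℕ → Fin m × Fin n × Fin 5 → ℝ} {c : Fin m} {τ τ' : ℕ}
    (h : HasReshuffleChain m n δ x c τ) (hτ : τ' ≤ τ) : HasReshuffleChain m n δ x c τ' := by
  obtain ⟨s, t, h1, h2, j, hj⟩ := h
  exact ⟨s, t, h1, h2, j, hτ.trans hj⟩

/-- A reshuffle adds the middle agent to the active set, which therefore is not yet final at time `t
j`. -/
theorem HasReshuffleChain.le_finalActiveTime {x : ℕ → Fin m × Fin n × Fin 5 → ℝ} {c : Fin m}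
    {τ : ℕ} (h : HasReshuffleChain m n δ x c τ) : (τ : ℝ≥0∞) ≤ finalActiveTime x := by
  obtain ⟨s, t, h1, -, j, hj⟩ := h
  refine le_iInf₂ fun r hr => ?_
  obtain ⟨hst, S, -, hS, -, -, hact⟩ := h1 j
  by_contra! hlt
  have hrτ : r < τ := by exact_mod_cast hlt
  have h3 : (c, j, 2) ∈ activeSet (x (t j + 1)) := hact
  rw [hr _ (by omega), ← hr (t j) (by omega)] at h3
  exact absurd (hS (t j) hst.le le_rfl).1 (ne_of_gt h3)

end Trajectory

end NetworkGame
end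

theorem mainTheorem5 (δ : ℝ) (hδ : δ ∈ Set.Ioo (1 / Real.goldenRatio) 1) (T k : ℕ) :
    ∃ (m n : ℕ) (_ : NeZero m) (_ : NeZero n),
      k ≤ n ∧
      (T : ℝ≥0∞) ≤ NetworkGame.expectedFinalRounds (NetworkGame.chainedPaths m n) δ 0 ∧
      (1 / 2 : ℝ≥0∞) ≤ NetworkGame.updateLaw (Fin m × Fin n × Fin 5)
        {ω | ∃ c : Fin m, NetworkGame.HasReshuffleChain m n δ
          (NetworkGame.trajectory (NetworkGame.chainedPaths m n) δ 0 ω) c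
          (T * Fintype.card (Fin m × Fin n × Fin 5))} := by
  open NetworkGame MeasureTheory in
  obtain ⟨h2δ, h3δ⟩ := one_lt_of_goldenRatio_inv_lt hδ.1
  have hδ' : δ ∈ Set.Ioo (0 : ℝ) 1 := ⟨by linarith, hδ.2⟩
  obtain ⟨w, hw⟩ := exists_reshuffleChain_word hδ' h2δ h3δ (k + 1)
  have hq : (0 : ℝ) < (1 / (Fintype.card (Fin (k + 1) × Fin 5) : ℝ)) ^ w.length := by
    have : (0 : ℝ) < Fintype.card (Fin (k + 1) × Fin 5) := by exact_mod_cast Fintype.card_pos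
    positivity
  -- The exponent `E` is chosen so that `m * E` is the number of steps in `2T` rounds; `w` is fixed
  -- before `m`.
  obtain ⟨m, hm, hm1⟩ := ((eventually_one_sub_pow_le_half hq
    (wordProb_le_one (some w)) (2 * T * ((k + 1) * 5))).and
      (Filter.eventually_ge_atTop 1)).exists
  have : NeZero m := ⟨by omega⟩
  set V := Fin m × Fin (k + 1) × Fin 5
  have hcard : Fintype.card V = m * ((k + 1) * 5) := by simp [V]
  set N := 2 * T * Fintype.card V with hN
  set A : Set (ℕ → V) := (NoneFollowsAfter (Finset.univ : Finset (Fin m)) N w)ᶜ with hA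
  have hAchain : ∀ ω ∈ A, ∃ c : Fin m, HasReshuffleChain m (k + 1) δ
      (trajectory (chainedPaths m (k + 1)) δ 0 ω) c N := by
    intro ω hω
    by_contra! hno
    exact hω fun c _ h => hno c (hw m c ω N h.1 h.2)
  have hmeas := measurableSet_noneFollowsAfter (Finset.univ : Finset (Fin m)) N w
  have hAhalf : (1 / 2 : ℝ≥0∞) ≤ updateLaw V A := by
    have h1 := updateLaw_noneFollowsAfter_le w N (Finset.univ : Finset (Fin m))
    rw [Finset.card_univ, Fintype.card_fin, hN, hcard,
      show 2 * T * (m * ((k + 1) * 5)) = m * (2 * T * ((k + 1) * 5)) by ring] at h1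
    have h2 := h1.trans hm
    have h3 : (1 / 2 : ℝ) ≤ (updateLaw V).real A := by
      rw [hA, probReal_compl_eq_one_sub hmeas, hN, hcard,
        show 2 * T * (m * ((k + 1) * 5)) = m * (2 * T * ((k + 1) * 5)) by ring]
      linarith
    have h4 := ENNReal.ofReal_le_ofReal h3
    rwa [ofReal_measureReal, ENNReal.ofReal_div_of_pos two_pos, ENNReal.ofReal_one,
      ENNReal.ofReal_ofNat] at h4
  refine ⟨m, k + 1, inferInstance, inferInstance, Nat.le_succ k, ?_, hAhalf.trans
    (measure_mono fun ω hω => ?_)⟩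
  · have hcard0 : (Fintype.card V : ℝ≥0∞) ≠ 0 := by simp
    calc (T : ℝ≥0∞) = (2 * T : ℕ) * (1 / 2) := by
          push_cast
          rw [mul_comm (2 : ℝ≥0∞), mul_assoc, one_div,
            ENNReal.mul_inv_cancel two_ne_zero ENNReal.ofNat_ne_top, mul_one]
      _ ≤ (2 * T : ℕ) * updateLaw V A := by gcongr
      _ = ∫⁻ _ in A, ((2 * T : ℕ) : ℝ≥0∞) ∂updateLaw V := by rw [setLIntegral_const]
      _ ≤ ∫⁻ ω in A, finalActiveTime (trajectory (chainedPaths m (k + 1)) δ 0 ω) /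
            (Fintype.card V : ℝ≥0∞) ∂updateLaw V := by
          refine setLIntegral_mono' hmeas.compl fun ω hω => ?_
          obtain ⟨c, hc⟩ := hAchain ω hω
          rw [ENNReal.le_div_iff_mul_le (Or.inl hcard0) (Or.inl (ENNReal.natCast_ne_top _))]
          exact_mod_cast hc.le_finalActiveTime
      _ ≤ _ := setLIntegral_le_lintegral _ _
  · obtain ⟨c, hc⟩ := hAchain ω hω
    exact ⟨c, hc.mono (Nat.mul_le_mul_right _ (by omega))⟩
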